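/- Let $b\ge 2$ and $\rho\ge 1$ be integers, let $\Lambda=(\lambda_1,\ldots,\lambda_\rho)$ be a sequence of integers with $1\le\lambda_1\le\cdots\le\lambda_\rho$, let $T=(t_{\ell,i})$ be a family of positive integers and $Z=(z_{\ell,i})$ a family of variables, both indexed by $1\le\ell\le\rho$, $1\le i\le\lambda_\ell$. Define the polynomials $\Omega_{b,T}^\Lambda(n;Z)\in\mathbb Z[Z]$, $n\ge 0$, by the generating function $$\sum_{n=0}^\infty \Omega_{b,T}^\Lambda(n;Z)q^n=\prod_{j=0}^\infty\prod_{\ell=1}^{\rho}\left(1+z_{\ell,1}^{t_{\ell,1}^j}q^{b^j}+z_{\ell,2}^{t_{\ell,2}^j}q^{2b^j}+\cdots+z_{\ell,\lambda_\ell}^{t_{\ell,\lambda_\ell}^j}q^{\lambda_\ell b^j}\right).$$ Let $M_b=\{\sum_{j\ge 0}c_jb^j : c_j\in\{0,1\},\ \text{only finitely many } c_j\neq 0\}$ be the set of nonnegative integers all of whose $b$-ary digits are $0$ or $1$. For $k=\sum_{j\ge0}c_jb^j\in M_b$ with $c_j\in\{0,1\}$ and an integer $t\ge1$ put $d_t^b(k)=\sum_{j\ge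 0}c_jt^j$. For $k_1,\ldots,k_m\in M_b$ let $$\binom{k_1+\cdots+k_m}{k_1,\ldots,k_m}_b^*\in\{0,1\}$$ be the least nonnegative residue modulo $2$ of the ordinary multinomial coefficient $$\binom{d_2^b(k_1)+\cdots+d_2^b(k_m)}{d_2^b(k_1),\ldots,d_2^b(k_m)}.$$ Then for each integer $n\ge 0$ we have $$\Omega_{b,T}^\Lambda(n;Z)=\sum\prod_{\ell=1}^{\rho}\binom{k_{\ell,1}+\cdots+k_{\ell,\lambda_\ell}}{k_{\ell,1},\ldots,k_{\ell,\lambda_\ell}}_b^*\,z_{\ell,1}^{d^b_{t_{\ell,1}}(k_{\ell,1})}\cdots z_{\ell,\lambda_\ell}^{d^b_{t_{\ell,\lambda_\ell}}(k_{\ell,\lambda_\ell})},$$ where the sum is taken over all families of integers $k_{\ell,i}\in M_b$ ($1\le\ell\le\rho$, $1\le i\le\lambda_\ell$) such that $\sum_{\ell=1}^{\rho}\sum_{i=1}^{\lambda_\ell} i\cdot k_{\ell,i}=n$. -/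

import Mathlib

namespace ColoredBAry

/-- The variables `z_{ℓ,i}`, for `1 ≤ ℓ ≤ ρ` and `1 ≤ i ≤ λ_ℓ`. The pair `⟨ℓ, i⟩` with
`ℓ : Fin ρ` and `i : Fin (Λ ℓ)` stands for the pair `(ℓ + 1, i + 1)` of the usual numbering. -/
abbrev Idx {ρ : ℕ} (Λ : Fin ρ → ℕ) : Type := Σ ℓ : Fin ρ, Fin (Λ ℓ)

/-- The polynomials in the variables `z_{ℓ,i}` with integer coefficients. -/
abbrev Poly {ρ : ℕ} (Λ : Fin ρ → ℕ) : Type := MvPolynomial (Idx Λ) ℤ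

/-- The non-constant part `∑_{i=1}^{λ_ℓ} z_{ℓ,i}^{t_{ℓ,i}^j} q^{i b^j}` of the factor of the
generating function that belongs to the colour `ℓ` and the power `b^j`. -/
noncomputable def factorTail {ρ : ℕ} (b : ℕ) (Λ : Fin ρ → ℕ) (T : (ℓ : Fin ρ) → Fin (Λ ℓ) → ℕ)
    (ℓ : Fin ρ) (j : ℕ) : PowerSeries (Poly Λ) :=
  ∑ i : Fin (Λ ℓ),
    PowerSeries.C ((MvPolynomial.X ⟨ℓ, i⟩ : Poly Λ) ^ (T ℓ i ^ j)) *
      PowerSeries.X ^ (((i : ℕ) + 1) * b ^ j)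

/-- The `j`-th factor
`∏_ℓ (1 + z_{ℓ,1}^{t_{ℓ,1}^j} q^{b^j} + ⋯ + z_{ℓ,λ_ℓ}^{t_{ℓ,λ_ℓ}^j} q^{λ_ℓ b^j})`
of the generating function, a power series in `q`. -/
noncomputable def factor {ρ : ℕ} (b : ℕ) (Λ : Fin ρ → ℕ) (T : (ℓ : Fin ρ) → Fin (Λ ℓ) → ℕ)
    (j : ℕ) : PowerSeries (Poly Λ) :=
  ∏ ℓ : Fin ρ, (1 + factorTail b Λ T ℓ j)

open scoped PowerSeries.WithPiTopology in
/-- The generating function `∏_{j ≥ 0} factor j`, an infinite product of formal power series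
(coefficientwise convergence: the polynomial ring carries the discrete topology). -/
noncomputable def genFun {ρ : ℕ} (b : ℕ) (Λ : Fin ρ → ℕ) (T : (ℓ : Fin ρ) → Fin (Λ ℓ) → ℕ) :
    PowerSeries (Poly Λ) :=
  letI : TopologicalSpace (Poly Λ) := ⊥
  ∏' j : ℕ, factor b Λ T j

open scoped PowerSeries.WithPiTopology in
/-- The infinite product that defines `genFun` converges. -/
theorem hasProd_genFun {ρ : ℕ} (b : ℕ) (hb : 2 ≤ b) (Λ : Fin ρ → ℕ)
    (T : (ℓ : Fin ρ) → Fin (Λ ℓ) → ℕ) :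
    letI : TopologicalSpace (Poly Λ) := ⊥
    HasProd (fun j : ℕ => factor b Λ T j) (genFun b Λ T) := by
  letI : TopologicalSpace (Poly Λ) := ⊥
  haveI : DiscreteTopology (Poly Λ) := ⟨rfl⟩
  have h : Multipliable (fun j : ℕ => factor b Λ T j) := by
    unfold factor
    refine multipliable_prod (fun ℓ _ => ?_)
    apply PowerSeries.WithPiTopology.multipliable_one_add_of_tendsto_order_atTop_nhds_top
    refine ENat.tendsto_nhds_top_iff_natCast_lt.mpr
      (fun n => Filter.eventually_atTop.mpr ⟨n, fun j hj => ?_⟩)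
    have hlt : n < b ^ j := lt_of_le_of_lt hj (Nat.lt_pow_self (by omega))
    refine lt_of_lt_of_le (by exact_mod_cast hlt : (n : ℕ∞) < ((b ^ j : ℕ) : ℕ∞)) ?_
    refine PowerSeries.nat_le_order _ _ (fun m hm => ?_)
    simp only [factorTail, map_sum]
    refine Finset.sum_eq_zero (fun i _ => ?_)
    rw [PowerSeries.coeff_C_mul, PowerSeries.coeff_X_pow, if_neg, mul_zero]
    have : b ^ j ≤ ((i : ℕ) + 1) * b ^ j := Nat.le_mul_of_pos_left _ (Nat.succ_pos _)
    omega
  exact h.hasProd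

/-- The polynomial `Ω_{b,T}^Λ(n; Z)`: the coefficient of `q^n` in the generating function. -/
noncomputable def Omega {ρ : ℕ} (b : ℕ) (Λ : Fin ρ → ℕ) (T : (ℓ : Fin ρ) → Fin (Λ ℓ) → ℕ)
    (n : ℕ) : Poly Λ :=
  PowerSeries.coeff n (genFun b Λ T)

/-- `M_b`: the numbers `∑_j c_j b^j` with all `c_j ∈ {0, 1}` (finitely many of them nonzero). -/
def M (b : ℕ) : Set ℕ :=
  {k | ∃ c : ℕ →₀ ℕ, (∀ j, c j = 0 ∨ c j = 1) ∧ k = c.sum (fun j a => a * b ^ j)}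

/-- `d_t^b(k) = ∑_j c_j t^j`, where the `c_j` are the digits of `k` in base `b`. -/
def d (b t k : ℕ) : ℕ := Nat.ofDigits t (Nat.digits b k)

/-- The modified multinomial coefficient attached to the base `b` and to `k_1, …, k_m ∈ M_b`: the
least nonnegative residue modulo `2` of the multinomial coefficient of
`d_2^b(k_1), …, d_2^b(k_m)`. -/
def starMultinomial (b : ℕ) {m : ℕ} (k : Fin m → ℕ) : ℕ :=
  Nat.multinomial Finset.univ (fun i => d b 2 (k i)) % 2

/-- The families `(k_{ℓ,i})` in `M_b` with `∑_ℓ ∑_i i k_{ℓ,i} = n`. -/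
def Solutions {ρ : ℕ} (b : ℕ) (Λ : Fin ρ → ℕ) (n : ℕ) : Set ((ℓ : Fin ρ) → Fin (Λ ℓ) → ℕ) :=
  {k | (∀ ℓ i, k ℓ i ∈ M b) ∧ ∑ ℓ : Fin ρ, ∑ i : Fin (Λ ℓ), ((i : ℕ) + 1) * k ℓ i = n}

theorem solutions_finite {ρ : ℕ} (b : ℕ) (Λ : Fin ρ → ℕ) (n : ℕ) :
    (Solutions b Λ n).Finite := by
  refine Set.Finite.subset (Set.finite_Iic (fun (ℓ : Fin ρ) (_ : Fin (Λ ℓ)) => n)) ?_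
  rintro k ⟨-, hk⟩ ℓ i
  calc k ℓ i ≤ ((i : ℕ) + 1) * k ℓ i := Nat.le_mul_of_pos_left _ (Nat.succ_pos _)
    _ ≤ ∑ i : Fin (Λ ℓ), ((i : ℕ) + 1) * k ℓ i :=
        Finset.single_le_sum (f := fun i : Fin (Λ ℓ) => ((i : ℕ) + 1) * k ℓ i)
          (fun _ _ => Nat.zero_le _) (Finset.mem_univ i)
    _ ≤ ∑ ℓ : Fin ρ, ∑ i : Fin (Λ ℓ), ((i : ℕ) + 1) * k ℓ i :=
        Finset.single_le_sum (f := fun ℓ : Fin ρ => ∑ i : Fin (Λ ℓ), ((i : ℕ) + 1) * k ℓ i)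
          (fun _ _ => Nat.zero_le _) (Finset.mem_univ ℓ)
    _ = n := hk

end ColoredBAry

namespace ColoredBAry

/-! Cut the infinite product off at `j < N`. To expand the factors of one colour, choose at each
position `j` either the term `1` or one index `i`; this amounts to pairwise disjoint finite sets `D
i` of positions. With `k i = ∑ j ∈ D i, b ^ j`, the exponents of the variables become `d b t (k i)`
and that of `q` becomes the weighted sum of the `k i`. By Lucas modulo 2, disjointness of the `D i`
says exactly that the multinomial coefficient of the numbers `∑ j ∈ D i, 2 ^ j` is odd, so
`starMultinomial` is its indicator and the sum may run over all families of sets. As `b ≥ 2`, finite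
sets correspond bijectively to elements of `M b`. -/

/-- `L` may end in zeros and so differ from the digit list of its value; dropping these zeros
changes neither side. -/
theorem d_ofDigits {b : ℕ} (hb : 2 ≤ b) (t : ℕ) (L : List ℕ) (hL : ∀ a ∈ L, a < b) :
    d b t (Nat.ofDigits b L) = Nat.ofDigits t L := by
  unfold d
  induction L with
  | nil => simp
  | cons a L ih =>
    have ih := ih fun x hx => hL x (List.mem_cons_of_mem _ hx)
    rw [Nat.ofDigits_cons, Nat.ofDigits_cons]
    by_cases h : a ≠ 0 ∨ Nat.ofDigits b L ≠ 0
    · rw [Nat.digits_add b (by omega) _ _ (hL a List.mem_cons_self) h, Nat.ofDigits_cons, ih]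
    -- Here `a = 0` and the tail has value `0`: the digit list is empty, and `ih` gives that `L`
    -- also evaluates to `0` at `t`.
    · push Not at h
      rw [h.2] at ih ⊢
      simp only [h.1, Nat.digits_zero, Nat.ofDigits_nil] at ih ⊢
      simp [← ih]

theorem ofDigits_map_range (t : ℕ) (f : ℕ → ℕ) (N : ℕ) :
    Nat.ofDigits t ((List.range N).map f) = ∑ j ∈ Finset.range N, f j * t ^ j := by
  induction N with
  | zero => simp
  | succ N ih =>
    rw [List.range_succ, List.map_append, Nat.ofDigits_append, ih, Finset.sum_range_succ]
    simp [mul_comm]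

theorem d_sum_pow {b : ℕ} (hb : 2 ≤ b) (t : ℕ) (D : Finset ℕ) :
    d b t (∑ j ∈ D, b ^ j) = ∑ j ∈ D, t ^ j := by
  obtain ⟨N, hN⟩ := D.exists_nat_subset_range
  have key : ∀ x : ℕ, ∑ j ∈ D, x ^ j =
      Nat.ofDigits x ((List.range N).map fun j => if j ∈ D then 1 else 0) := by
    intro x
    rw [ofDigits_map_range]
    simp only [ite_mul, one_mul, zero_mul]
    rw [Finset.sum_ite_mem, Finset.inter_eq_right.mpr hN]
  rw [key b, key t, d_ofDigits hb]
  intro a ha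
  obtain ⟨j, -, rfl⟩ := List.mem_map.mp ha
  split_ifs <;> omega

/-- Lucas' theorem modulo 2 peels off the lowest bit. Without a carry the halves add up and the
induction continues. -/
theorem odd_choose_add_iff (x y : ℕ) :
    Odd ((x + y).choose x) ↔ ∀ j, ¬ (x.testBit j = true ∧ y.testBit j = true) := by
  induction x using Nat.strong_induction_on generalizing y with
  | _ x ih =>
  rcases Nat.eq_zero_or_pos x with rfl | hx
  · simp
  have hl : Odd ((x + y).choose x) ↔
      Odd (((x + y) % 2).choose (x % 2) * ((x + y) / 2).choose (x / 2)) := by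
    rw [Nat.odd_iff, Nat.odd_iff,
      (Choose.choose_modEq_choose_mod_mul_choose_div_nat (p := 2) : _ ≡ _ [MOD 2])]
  have hsplit : (∀ j, ¬ (x.testBit j = true ∧ y.testBit j = true)) ↔
      ¬ (x % 2 = 1 ∧ y % 2 = 1) ∧
        ∀ j, ¬ ((x / 2).testBit j = true ∧ (y / 2).testBit j = true) := by
    constructor
    · intro h
      refine ⟨by simpa [Nat.testBit_zero] using h 0, fun j => ?_⟩
      simpa only [Nat.testBit_add_one] using h (j + 1)
    · rintro ⟨h0, h⟩ (_ | j)
      · simpa [Nat.testBit_zero] using h0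
      · simpa only [Nat.testBit_add_one] using h j
  rw [hl, hsplit, ← ih (x / 2) (by omega) (y / 2)]
  rcases Nat.mod_two_eq_zero_or_one x with h1 | h1 <;>
    rcases Nat.mod_two_eq_zero_or_one y with h2 | h2
  · rw [show (x + y) % 2 = 0 by omega, show (x + y) / 2 = x / 2 + y / 2 by omega]
    simp [h1]
  · rw [show (x + y) % 2 = 1 by omega, show (x + y) / 2 = x / 2 + y / 2 by omega]
    simp [h1]
  · rw [show (x + y) % 2 = 1 by omega, show (x + y) / 2 = x / 2 + y / 2 by omega]
    simp [h1, h2]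
  -- A carry: the Lucas factor is `choose 0 1 = 0`.
  · rw [show (x + y) % 2 = 0 by omega]
    simp [h1, h2]

theorem testBit_sum_two_pow (D : Finset ℕ) (j : ℕ) :
    (∑ i ∈ D, 2 ^ i).testBit j = true ↔ j ∈ D := by
  conv_rhs => rw [← Finset.toFinset_bitIndices_sum_two_pow D]
  rw [List.mem_toFinset, Nat.mem_bitIndices]

theorem odd_choose_sum_two_pow_iff (A B : Finset ℕ) :
    Odd ((∑ i ∈ A, 2 ^ i + ∑ i ∈ B, 2 ^ i).choose (∑ i ∈ A, 2 ^ i)) ↔ Disjoint A B := by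
  rw [odd_choose_add_iff, Finset.disjoint_left]
  simp only [testBit_sum_two_pow, not_and]

theorem odd_multinomial_sum_two_pow_iff {ι : Type*} (s : Finset ι) (D : ι → Finset ℕ) :
    Odd (Nat.multinomial s fun i => ∑ j ∈ D i, 2 ^ j) ↔ (s : Set ι).PairwiseDisjoint D := by
  classical
  induction s using Finset.induction_on with
  | empty => simp
  | insert a s ha ih =>
    rw [Nat.multinomial_insert ha, Nat.odd_mul, ih, Finset.coe_insert,
      Set.pairwiseDisjoint_insert_of_notMem (by simpa using ha), and_comm]
    -- Once the sets over `s` are disjoint, their sums combine into one sum over the union, leaving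
    -- the case of two sets.
    refine and_congr_right fun h => ?_
    rw [← Finset.sum_biUnion h, odd_choose_sum_two_pow_iff, Finset.disjoint_biUnion_right]
    simp

open Classical in
theorem starMultinomial_sum_pow {b : ℕ} (hb : 2 ≤ b) {m : ℕ} (D : Fin m → Finset ℕ) :
    starMultinomial b (fun i => ∑ j ∈ D i, b ^ j) =
      if Pairwise (Function.onFun Disjoint D) then 1 else 0 := by
  have h := odd_multinomial_sum_two_pow_iff Finset.univ D
  rw [Finset.coe_univ, Set.PairwiseDisjoint, Set.pairwise_univ] at h
  simp only [starMultinomial, d_sum_pow hb]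
  split_ifs with hD
  · exact Nat.odd_iff.mp (h.mpr hD)
  · exact Nat.not_odd_iff.mp (mt h.mp hD)

open Classical in
/-- Expansion of a product of factors `1 + ∑ i, A i j`: choosing a term from each factor amounts to
choosing pairwise disjoint sets `D i` of the positions where the `i`-th term is taken. -/
theorem prod_one_add_sum {R ι : Type*} [CommSemiring R] [Fintype ι] [DecidableEq ι]
    (s : Finset ℕ) (A : ι → ℕ → R) :
    ∏ j ∈ s, (1 + ∑ i, A i j) =
      ∑ D ∈ Fintype.piFinset fun _ : ι => s.powerset,
        if Pairwise (Function.onFun Disjoint D) then ∏ i, ∏ j ∈ D i, A i j else 0 := by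
  -- `none` stands for choosing the term `1`.
  have h1 : ∀ j, 1 + ∑ i, A i j = ∑ o : Option ι, o.elim 1 fun i => A i j := fun j => by
    rw [Fintype.sum_option]; rfl
  simp only [h1]
  rw [Finset.prod_sum, ← Finset.sum_filter]
  refine Finset.sum_bij
    (fun f _ i => s.filter fun j => ∃ h : j ∈ s, f j h = some i) ?_ ?_ ?_ ?_
  · intro f _
    refine Finset.mem_filter.mpr ⟨?_, fun i i' hii => ?_⟩
    · simp [Fintype.mem_piFinset, Finset.filter_subset]
    · refine Finset.disjoint_left.mpr fun j hj hj' => hii ?_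
      obtain ⟨-, hs, h⟩ := Finset.mem_filter.mp hj
      obtain ⟨-, _, h'⟩ := Finset.mem_filter.mp hj'
      exact Option.some_injective _ (h.symm.trans h')
  · intro f _ g _ hfg
    funext j hj
    refine Option.ext fun i => ?_
    have := congrArg (j ∈ ·) (congrFun hfg i)
    simpa [hj] using this
  · intro D hD
    obtain ⟨hD, hdis⟩ := Finset.mem_filter.mp hD
    have hsub : ∀ i, D i ⊆ s := by simpa [Fintype.mem_piFinset] using hD
    refine ⟨fun j _ => if h : ∃ i, j ∈ D i then some h.choose else none, by simp, ?_⟩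
    funext i
    ext j
    simp only [Finset.mem_filter, exists_prop]
    constructor
    · rintro ⟨-, -, h⟩
      split_ifs at h with h'
      exact Option.some_injective _ h ▸ h'.choose_spec
    · intro hj
      have h' : ∃ i, j ∈ D i := ⟨i, hj⟩
      refine ⟨hsub i hj, hsub i hj, ?_⟩
      rw [dif_pos h']
      -- Disjointness leaves only one `i` with `j ∈ D i`, so the chosen index is this one.
      by_contra hne
      exact Finset.disjoint_left.mp (hdis fun he => hne (congrArg some he)) h'.choose_spec hj
  · intro f _
    simp only [Finset.prod_filter]
    rw [Finset.prod_comm, ← Finset.prod_attach s]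
    refine Finset.prod_congr rfl fun j _ => ?_
    cases h : f j.1 j.2 with
    | none => simp [h]
    | some i =>
      simp [h]

theorem mem_M_iff {b k : ℕ} : k ∈ M b ↔ ∃ D : Finset ℕ, ∑ j ∈ D, b ^ j = k := by
  classical
  constructor
  · rintro ⟨c, hc, rfl⟩
    refine ⟨c.support, Finset.sum_congr rfl fun j hj => ?_⟩
    simp [(hc j).resolve_left (Finsupp.mem_support_iff.mp hj)]
  · rintro ⟨D, rfl⟩
    refine ⟨Finsupp.indicator D fun _ _ => 1, fun j => ?_, ?_⟩
    · by_cases h : j ∈ D <;> simp [h]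
    · rw [Finsupp.sum_of_support_subset _ (Finsupp.support_indicator_subset _ _) _ (by simp)]
      exact Finset.sum_congr rfl fun j hj => by simp [hj]

/-- The summand of the explicit formula that belongs to the colour `ℓ` and the numbers
`k_{ℓ,1}, …, k_{ℓ,λ_ℓ}`. -/
noncomputable def colorTerm {ρ : ℕ} (b : ℕ) (Λ : Fin ρ → ℕ) (T : (ℓ : Fin ρ) → Fin (Λ ℓ) → ℕ)
    (ℓ : Fin ρ) (k : Fin (Λ ℓ) → ℕ) : Poly Λ :=
  ((starMultinomial b k : ℕ) : Poly Λ) *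
    ∏ i : Fin (Λ ℓ), (MvPolynomial.X ⟨ℓ, i⟩ : Poly Λ) ^ d b (T ℓ i) (k i)

theorem prod_one_add_factorTail {ρ : ℕ} {b : ℕ} (hb : 2 ≤ b) (Λ : Fin ρ → ℕ)
    (T : (ℓ : Fin ρ) → Fin (Λ ℓ) → ℕ) (ℓ : Fin ρ) (s : Finset ℕ) :
    ∏ j ∈ s, (1 + factorTail b Λ T ℓ j) =
      ∑ D ∈ Fintype.piFinset fun _ : Fin (Λ ℓ) => s.powerset,
        PowerSeries.C (colorTerm b Λ T ℓ fun i => ∑ j ∈ D i, b ^ j) *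
          PowerSeries.X ^ (∑ i : Fin (Λ ℓ), ((i : ℕ) + 1) * ∑ j ∈ D i, b ^ j) := by
  unfold factorTail
  rw [prod_one_add_sum]
  refine Finset.sum_congr rfl fun D _ => ?_
  rw [colorTerm, starMultinomial_sum_pow hb]
  split_ifs with h
  · simp only [Finset.prod_mul_distrib, d_sum_pow hb, Nat.cast_one, one_mul, map_prod,
      Finset.prod_pow_eq_pow_sum, Finset.mul_sum, map_pow]
  · simp

theorem prod_factor {ρ : ℕ} {b : ℕ} (hb : 2 ≤ b) (Λ : Fin ρ → ℕ)
    (T : (ℓ : Fin ρ) → Fin (Λ ℓ) → ℕ) (s : Finset ℕ) :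
    ∏ j ∈ s, factor b Λ T j =
      ∑ D ∈ Fintype.piFinset fun ℓ : Fin ρ => Fintype.piFinset fun _ : Fin (Λ ℓ) => s.powerset,
        PowerSeries.C (∏ ℓ, colorTerm b Λ T ℓ fun i => ∑ j ∈ D ℓ i, b ^ j) *
          PowerSeries.X ^ (∑ ℓ, ∑ i : Fin (Λ ℓ), ((i : ℕ) + 1) * ∑ j ∈ D ℓ i, b ^ j) := by
  unfold factor
  rw [Finset.prod_comm]
  simp only [prod_one_add_factorTail hb]
  rw [Finset.prod_univ_sum]
  refine Finset.sum_congr rfl fun D _ => ?_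
  rw [Finset.prod_mul_distrib, Finset.prod_pow_eq_pow_sum, map_prod]

theorem coeff_prod_range_factor {ρ : ℕ} {b : ℕ} (hb : 2 ≤ b) (Λ : Fin ρ → ℕ)
    (T : (ℓ : Fin ρ) → Fin (Λ ℓ) → ℕ) {n N : ℕ} (hN : n ≤ N) :
    PowerSeries.coeff n (∏ j ∈ Finset.range N, factor b Λ T j) =
      ∑ k ∈ (solutions_finite b Λ n).toFinset, ∏ ℓ, colorTerm b Λ T ℓ (k ℓ) := by
  rw [prod_factor hb, map_sum]
  simp only [PowerSeries.coeff_C_mul_X_pow]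
  rw [← Finset.sum_filter]
  refine Finset.sum_bij (fun D _ ℓ i => ∑ j ∈ D ℓ i, b ^ j) ?_ ?_ ?_ fun _ _ => rfl
  · intro D hD
    rw [Set.Finite.mem_toFinset]
    exact ⟨fun ℓ i => mem_M_iff.mpr ⟨_, rfl⟩, (Finset.mem_filter.mp hD).2.symm⟩
  · intro D _ E _ h
    funext ℓ i
    -- Expansions in base `b` with digits `0` and `1` are unique.
    exact Finset.geomSum_injective hb (congrFun (congrFun h ℓ) i)
  · intro k hk
    rw [Set.Finite.mem_toFinset] at hk
    choose D hD using fun ℓ i => mem_M_iff.mp (hk.1 ℓ i)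
    have hle : ∀ ℓ i, k ℓ i ≤ n := fun ℓ i => by
      rw [← hk.2]
      calc k ℓ i ≤ ((i : ℕ) + 1) * k ℓ i := Nat.le_mul_of_pos_left _ (Nat.succ_pos _)
        _ ≤ ∑ i : Fin (Λ ℓ), ((i : ℕ) + 1) * k ℓ i :=
            Finset.single_le_sum (f := fun i : Fin (Λ ℓ) => ((i : ℕ) + 1) * k ℓ i)
              (fun _ _ => Nat.zero_le _) (Finset.mem_univ i)
        _ ≤ _ := Finset.single_le_sum
              (f := fun ℓ : Fin ρ => ∑ i : Fin (Λ ℓ), ((i : ℕ) + 1) * k ℓ i)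
              (fun _ _ => Nat.zero_le _) (Finset.mem_univ ℓ)
    refine ⟨D, Finset.mem_filter.mpr ⟨?_, ?_⟩, ?_⟩
    · simp only [Fintype.mem_piFinset, Finset.mem_powerset]
      intro ℓ i j hj
      -- A used position satisfies `j < k ℓ i ≤ n ≤ N`, so the truncation loses no solution.
      have := Finset.lt_geomSum_of_mem hb hj
      rw [hD] at this
      exact Finset.mem_range.mpr (this.trans_le ((hle ℓ i).trans hN))
    · simp only [hD]
      exact hk.2.symm
    · funext ℓ i
      exact hD ℓ i

open scoped PowerSeries.WithPiTopology in
theorem eventually_coeff_prod_range_factor {ρ : ℕ} {b : ℕ} (hb : 2 ≤ b) (Λ : Fin ρ → ℕ)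
    (T : (ℓ : Fin ρ) → Fin (Λ ℓ) → ℕ) (n : ℕ) :
    ∀ᶠ N in Filter.atTop,
      PowerSeries.coeff n (∏ j ∈ Finset.range N, factor b Λ T j) = Omega b Λ T n := by
  let : TopologicalSpace (Poly Λ) := ⊥
  have : DiscreteTopology (Poly Λ) := ⟨rfl⟩
  have h := ((PowerSeries.WithPiTopology.continuous_coeff (Poly Λ) n).tendsto _).comp
    (hasProd_genFun b hb Λ T).tendsto_prod_nat
  -- In a discrete ring, convergence of a coefficient means that it is eventually constant.
  rw [nhds_discrete, Filter.tendsto_pure] at h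
  exact h

end ColoredBAry

theorem theorem6p3 (b ρ : ℕ) (hb : 2 ≤ b) (hρ : 1 ≤ ρ)
    (Λ : Fin ρ → ℕ) (hΛ_pos : ∀ ℓ, 1 ≤ Λ ℓ) (hΛ_mono : Monotone Λ)
    (T : (ℓ : Fin ρ) → Fin (Λ ℓ) → ℕ) (hT : ∀ ℓ i, 1 ≤ T ℓ i) (n : ℕ) :
    ColoredBAry.Omega b Λ T n =
      ∑ k ∈ (ColoredBAry.solutions_finite b Λ n).toFinset,
        ∏ ℓ : Fin ρ,
          (((ColoredBAry.starMultinomial b (k ℓ) : ℕ) : ColoredBAry.Poly Λ) *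
            ∏ i : Fin (Λ ℓ),
              (MvPolynomial.X ⟨ℓ, i⟩ : ColoredBAry.Poly Λ) ^
                ColoredBAry.d b (T ℓ i) (k ℓ i)) := by
  obtain ⟨N, h, hN⟩ := ((ColoredBAry.eventually_coeff_prod_range_factor hb Λ T n).and
    (Filter.eventually_ge_atTop n)).exists
  rw [← h, ColoredBAry.coeff_prod_range_factor hb Λ T hN]
  rfl
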